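/- **Setting.** Fix a mode change of a multimode DAE system all of whose modes are long. After index reduction, conflict resolution and introduction of auxiliary variables, the system that determines the restart has the form $0=\mathbf H(\dot X,X^{\bullet},V,X)$, where $\mathbf H$ is a standard (real) vector function, $X$ are the state variables, and the algebraic variables are split as $V=(W',W)$ with $W'$ impulsive and $W$ non-impulsive. (The statement below holds for every such $\mathbf H$.) Write $x^{\bullet n}$ for the value of $x$ at $n$ nonstandard time steps after the current one ($n\in\mathbb Z$). The ultrapower ${}^*\mathbb R=\mathbb R^{\mathbb N}/\mathcal U$, with $\mathcal U$ a free ultrafilter, is used as the field of nonstandard reals. An *expansion of the derivative* is a tuple $\mathbf a=(\alpha_P,\dots,\alpha_N)$ of reals with $P\le N$, $N\ge 0$, $\alpha_N\ne 0$, $\sum_{n=P}^N\alpha_n=1$; it interprets $\partial\cdot\dot X$ as $\sum_{n=P}^{N}\alpha_n\,(X^{\bullet(n+1)}-X^{\bullet n})$. The Euler scheme is $P=N=0$, $\alpha_0=1$. With the expansion $\mathbf a$, the values $X^{\bullet n}$, $\min(P,0)\le n\le N$, are known from the previous long mode, and the dependent variables are $X^{\bullet(N+1)}$, $W'$, $W$;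 put $Y=(X^{\bullet(N+1)},W)$. The shifted state $X^\bullet$ in $\mathbf H$ is read in one of two ways: (S) as the $(N+1)$-fold shift $X^{\bullet (N+1)}$ (all offsets of the index reduction being multiplied by $N+1$), or (O) as the one-step shift $X^{\bullet 1}$. **Assumptions.** The left limit $X^-$ of the states is a standard real vector. There is a reduced system $\mathbf K$ with $$\mathbf K(\dot X,X^\bullet,W,X)=0\iff \exists W'.\ \mathbf H(\dot X,X^\bullet,(W',W),X)=0$$ for all real values of $\dot X,X^\bullet,W,X$. For each expansion $\mathbf a$ considered, there is a $C^1$ function $K_{\mathbf a}(Y,(X^{\bullet n})_{n\le N},\delta)$, including at $\delta=0$, each of whose components equals, for $\delta\neq0$, the corresponding component of $\mathbf K$ with $\dot X$ replaced by $\frac1\delta\sum_{n=P}^{N}\alpha_n(X^{\bullet(n+1)}-X^{\bullet n})$, multiplied by a nonzero factor that depends only on $\delta$; and the system $K_{\mathbf a}(Y,X,0)=0$ obtained by setting $\delta=0$ and $X^{\bullet n}=X$ for all $n\le N$ is structurally nonsingular in the dependent variables $Y$, i.e. its bipartite graph (an edge joins an equation to each variable that occurs in it) has a complete matching. The *standardized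 restart system* for $\mathbf a$ is $K_{\mathbf a}(Y^+,X^-,0)=0$, with unknown $Y^+=(X^+,W^+)$. **Theorem.** Let $\mathbf a$ and $\mathbf b$ be two expansions of the derivative satisfying these assumptions, with the same $\mathbf H$ and $\mathbf K$. Under reading (O) assume moreover that the upper indices $N$ of $\mathbf a$ and $\mathbf b$ are both zero or both positive; under reading (S) nothing more is assumed. Then the standardized restart conditions do not depend on the expansion: 1. $K_{\mathbf a}(Y^+,X^-,0)=0$ and $K_{\mathbf b}(Y^+,X^-,0)=0$ have the same solutions $Y^+$. 2. Let $\partial>0$ be any infinitesimal and let the known values $X^{\bullet n}$, $n\le N$, be any nonstandard vectors with standard part $X^-$ (separately for $\mathbf a$ and for $\mathbf b$). For each of $\mathbf a$, $\mathbf b$, call $Y^+$ a restart value if $Y^+$ is the standard part of the component $Y$ of some nonstandard solution $(Y,W')$ of the correspondingly expanded system $\mathbf H=0$ with time step $\partial$. Then, for both expansions, every restart value solves $K_{\mathbf a}(Y^+,X^-,0)=0$, and every solution of this system at which the Jacobian with respect to $Y$ is nonsingular is a restart value. In particular, at each $Y^+$ where this Jacobian is nonsingular, $Y^+$ is a restart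 value for $\mathbf a$ if and only if it is one for $\mathbf b$. -/

import Mathlib

/-! ### Nonstandard analysis: the ultrapower construction -/

/-- The nonstandard extension of a set `E`: sequences of elements of `E`, identified when they agree
on a set of indices that belongs to a fixed free ultrafilter on `ℕ`. -/
abbrev Nst (E : Type*) : Type _ := Filter.Germ (Filter.hyperfilter ℕ : Filter ℕ) E

/-- `z` has standard part `x`: the distance between `z` and `x` is infinitesimal. -/
def HasStandardPart {E : Type*} [PseudoMetricSpace E] (z : Nst E) (x : E) : Prop :=
  ∀ r : ℝ, 0 < r → Filter.Germ.map (fun p => dist p x) z < (r : Nst ℝ)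

/-- A positive infinitesimal, the time step of the nonstandard semantics. -/
def IsPositiveInfinitesimal (d : Nst ℝ) : Prop :=
  0 < d ∧ HasStandardPart d 0

/-! ### Expansions of the derivative -/

/-- The data of an expansion `∂ · ẋ = ∑_{n=P}^{N} α_n (x^{•(n+1)} - x^{•n})` of the derivative, where
`x^{•n}` is the `n`-fold shift of `x` (a backward shift for `n < 0`). The explicit Euler scheme is
`P = N = 0`, `α_0 = 1`. Only the values of `α` on `[P, N]` are used. -/
structure DerivativeExpansion where
  P : ℤ
  N : ℤ
  α : ℤ → ℝ
  P_le_N : P ≤ N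
  N_nonneg : 0 ≤ N
  α_N_ne_zero : α N ≠ 0
  sum_α : ∑ n ∈ Finset.Icc P N, α n = 1

/-- How the forward shift `X•` in the restart equations is read when derivatives are expanded by a
scheme of order `M = N + 1`. With `stretched`, `X•` becomes the `M`-fold shift, as is the case of the
shifts that are produced by index reduction, since all the offsets are multiplied by `M`. With
`oneStep`, `X•` remains the shift by one nonstandard instant. For the Euler scheme both agree. -/
inductive ShiftConvention where
  | stretched
  | oneStep

namespace DerivativeExpansion

/-- The shifts `n` for which `x^{•n}` occurs and is already known at the mode change. -/
abbrev Known (e : DerivativeExpansion) : Type :=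
  ↥(Finset.Icc (min e.P 0) e.N)

/-- The known values when all of them are equal to `x`. -/
def constKnown {E : Type*} (e : DerivativeExpansion) (x : E) : e.Known → E := fun _ => x

/-- `x^{•n}` for `min P 0 ≤ n ≤ N + 1`: a known value if `n ≤ N`, and the dependent variable
`next` for `n = N + 1`. -/
noncomputable def value {E : Type*} (e : DerivativeExpansion) (h : e.Known → E) (next : E) (n : ℤ) : E :=
  if hn : n ∈ Finset.Icc (min e.P 0) e.N then h ⟨n, hn⟩ else next

/-- `∂ · ẋ`, that is `∑_{n=P}^{N} α_n (x^{•(n+1)} - x^{•n})`. -/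
noncomputable def increment {E : Type*} [AddCommGroup E] [Module ℝ E] (e : DerivativeExpansion)
    (h : e.Known → E) (next : E) : E :=
  ∑ n ∈ Finset.Icc e.P e.N, e.α n • (e.value h next (n + 1) - e.value h next n)

/-- The meaning of the shifted state `X•`. -/
noncomputable def shifted {E : Type*} (e : DerivativeExpansion) (c : ShiftConvention) (h : e.Known → E)
    (next : E) : E :=
  match c with
  | .stretched => e.value h next (e.N + 1)
  | .oneStep => e.value h next 1

/-- The system `F(Ẋ, X•, W, X)` in which `Ẋ` is expanded with the scheme `e` and step size `δ`. -/
noncomputable def expand {E A B : Type*} [AddCommGroup E] [Module ℝ E] (e : DerivativeExpansion)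
    (c : ShiftConvention) (F : E → E → A → E → B) (next : E) (w : A) (h : e.Known → E) (δ : ℝ) : B :=
  F (δ⁻¹ • e.increment h next) (e.shifted c h next) w (e.value h next 0)

end DerivativeExpansion

/-! ### Structural nonsingularity -/

/-- The variable `j` occurs in the function `f` with parameters in `Q` and dependent variables
indexed by `σ`. -/
def VariableOccurs {Q σ : Type*} (f : Q → (σ → ℝ) → ℝ) (j : σ) : Prop :=
  ∃ (q : Q) (y y' : σ → ℝ), (∀ k, k ≠ j → y k = y' k) ∧ f q y ≠ f q y'

/-- The bipartite graph of the system `F q y = 0`, with an edge between the equation `i` and the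
dependent variable `j` if `j` occurs in the equation `i`, has a complete matching. -/
def StructurallyNonsingular {Q σ η : Type*} (F : Q → (σ → ℝ) → η → ℝ) : Prop :=
  ∃ m : η ≃ σ, ∀ i, VariableOccurs (fun q y => F q y i) (m i)

/-! ### Restart systems

The state variables are indexed by `ι`, the impulsive algebraic variables by `κ`, the non-impulsive
ones by `ν`. The non-impulsive dependent variables `Y = (X^{•(N+1)}, W)` are indexed by `ι ⊕ ν`. -/

section Restart

variable {ι κ ν ε η : Type*}

/-- The impulsive variables can be eliminated from `H(Ẋ, X•, (W', W), X) = 0`, with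
`K(Ẋ, X•, W, X) = 0` as the reduced system. -/
def EliminatesImpulsive
    (H : (ι → ℝ) → (ι → ℝ) → (κ → ℝ) × (ν → ℝ) → (ι → ℝ) → ε → ℝ)
    (K : (ι → ℝ) → (ι → ℝ) → (ν → ℝ) → (ι → ℝ) → η → ℝ) : Prop :=
  ∀ dx sx w x, K dx sx w x = 0 ↔ ∃ w' : κ → ℝ, H dx sx (w', w) x = 0

/-- `Kd(Y, X, δ)` is derived from the reduced system `K(Ẋ, X•, W, X)` by expanding `Ẋ` with the
scheme `e`: for `δ ≠ 0` it is the expanded system, each equation being multiplied by a nonzero factor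
that depends only on `δ` (this clears the negative powers of `δ`), and it is of class `C¹`, including
at `δ = 0`. Moreover the system that results for `δ = 0` and `X^{•n} = X` for all known shifts is
structurally nonsingular. -/
structure IsDerivedReducedSystem [Fintype ι] [Fintype ν] [Fintype η]
    (e : DerivativeExpansion) (c : ShiftConvention)
    (K : (ι → ℝ) → (ι → ℝ) → (ν → ℝ) → (ι → ℝ) → η → ℝ)
    (Kd : (ι ⊕ ν → ℝ) × (e.Known → ι → ℝ) × ℝ → η → ℝ) : Prop where
  contDiff : ContDiff ℝ 1 Kd
  derived : ∃ ρ : η → ℝ → ℝ, (∀ i δ, δ ≠ 0 → ρ i δ ≠ 0) ∧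
    ∀ (y : ι ⊕ ν → ℝ) (h : e.Known → ι → ℝ) (δ : ℝ), δ ≠ 0 → ∀ i,
      Kd (y, h, δ) i = ρ i δ * e.expand c K (y ∘ Sum.inl) (y ∘ Sum.inr) h δ i
  structurallyNonsingular :
    StructurallyNonsingular (fun (x : ι → ℝ) y => Kd (y, e.constKnown x, 0))

/-- The standardized restart system `K(Y⁺, X⁻, 0)`, as a function of `Y⁺ = (X⁺, W⁺)`. -/
def standardizedRestart {e : DerivativeExpansion}
    (Kd : (ι ⊕ ν → ℝ) × (e.Known → ι → ℝ) × ℝ → η → ℝ) (xminus : ι → ℝ) :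
    (ι ⊕ ν → ℝ) → η → ℝ :=
  fun y => Kd (y, e.constKnown xminus, 0)

/-- `y = (X⁺, W⁺)` is the standard part of the non-impulsive part of a nonstandard solution
`(X^{•(N+1)}, W', W)` of the (nonstandard lifting of the) restart system `H(Ẋ, X•, (W', W), X) = 0`,
where `Ẋ` is expanded with the scheme `e` and time step `d`, and `h` collects the known `X^{•n}`. -/
def IsRestartValue [Fintype ι] [Fintype ν] (e : DerivativeExpansion) (c : ShiftConvention)
    (H : (ι → ℝ) → (ι → ℝ) → (κ → ℝ) × (ν → ℝ) → (ι → ℝ) → ε → ℝ)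
    (d : Nst ℝ) (h : Nst (e.Known → ι → ℝ)) (y : ι ⊕ ν → ℝ) : Prop :=
  ∃ (Y : Nst (ι ⊕ ν → ℝ)) (W' : Nst (κ → ℝ)),
    Filter.Germ.map₂
      (fun (z : (ι ⊕ ν → ℝ) × (κ → ℝ)) (p : (e.Known → ι → ℝ) × ℝ) =>
        e.expand c H (z.1 ∘ Sum.inl) (z.2, z.1 ∘ Sum.inr) p.1 p.2)
      (Filter.Germ.map₂ Prod.mk Y W') (Filter.Germ.map₂ Prod.mk h d) = 0 ∧
    HasStandardPart Y y

/-- The standard system `S = 0` is a standardization of the restart system: every finite nonstandard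
solution has a standard part that solves `S = 0`, and conversely every solution of `S = 0` at which
the Jacobian of `S` is nonsingular is the standard part of a nonstandard solution. -/
def IsStandardization [Fintype ι] [Fintype ν] [Fintype η] (e : DerivativeExpansion)
    (c : ShiftConvention)
    (H : (ι → ℝ) → (ι → ℝ) → (κ → ℝ) × (ν → ℝ) → (ι → ℝ) → ε → ℝ)
    (d : Nst ℝ) (h : Nst (e.Known → ι → ℝ)) (S : (ι ⊕ ν → ℝ) → η → ℝ) : Prop :=
  (∀ y, IsRestartValue e c H d h y → S y = 0) ∧
  (∀ y, S y = 0 → Function.Bijective (fderiv ℝ S y) → IsRestartValue e c H d h y)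

end Restart

open Filter Topology

/-! ### Standard parts as limits along the ultrafilter -/

/-! When all known values equal `x`, only the top term of the expansion survives and the increment
is `α_N • (next - x)`. Two schemes then differ only by the rescaling `δ ↦ tδ`, where `t` is the
ratio of their leading coefficients. Hence `Ka(y, x, δ)_i = q(δ) Kb(y, x, tδ)_i`, with `q`
independent of `x` and `y`. Structural nonsingularity prevents any component from vanishing
identically at `δ = 0`, so by continuity `q` tends to some `r_i ≠ 0`, and the standardized systems
are proportional componentwise (`exists_proportional`).

For restart values, nonstandard objects are represented by sequences and standard parts become
limits along the ultrafilter. Continuity of `Kd` at `δ = 0` shows that restart values solve the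
standardized system; the implicit function theorem gives the converse at nonsingular solutions
(`isStandardization`). -/

theorem hasStandardPart_coe {E : Type*} [PseudoMetricSpace E] {f : ℕ → E} {x : E} :
    HasStandardPart (f : Nst E) x ↔ Tendsto f (hyperfilter ℕ : Filter ℕ) (𝓝 x) := by
  rw [Metric.tendsto_nhds]
  exact forall₂_congr fun r _ => Germ.coe_lt

theorem isPositiveInfinitesimal_coe {d : ℕ → ℝ} :
    IsPositiveInfinitesimal (d : Nst ℝ) ↔
      (∀ᶠ n in (hyperfilter ℕ : Filter ℕ), 0 < d n) ∧
        Tendsto d (hyperfilter ℕ : Filter ℕ) (𝓝 0) :=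
  and_congr Germ.coe_pos hasStandardPart_coe

/-! ### Expansions at constant known values -/

namespace DerivativeExpansion

variable {E : Type*} (e : DerivativeExpansion)

theorem value_constKnown_of_mem (x next : E) {n : ℤ} (hn : n ∈ Finset.Icc (min e.P 0) e.N) :
    e.value (e.constKnown x) next n = x := by
  simp only [value, dif_pos hn, constKnown]

theorem value_of_lt (h : e.Known → E) (next : E) {n : ℤ} (hn : e.N < n) :
    e.value h next n = next :=
  dif_neg fun hmem => (Finset.mem_Icc.1 hmem).2.not_gt hn

theorem value_constKnown_zero (x next : E) : e.value (e.constKnown x) next 0 = x :=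
  e.value_constKnown_of_mem x next (Finset.mem_Icc.2 ⟨min_le_right _ _, e.N_nonneg⟩)

/-- For `n < N` both `n` and `n + 1` are known offsets, so the difference vanishes; only `n = N`
reaches the unknown. -/
theorem increment_constKnown [AddCommGroup E] [Module ℝ E] (x next : E) :
    e.increment (e.constKnown x) next = e.α e.N • (next - x) := by
  have hmin := min_le_left e.P 0
  have hPN := e.P_le_N
  rw [increment, Finset.sum_eq_single_of_mem e.N (Finset.right_mem_Icc.2 e.P_le_N)]
  · rw [e.value_of_lt _ _ (lt_add_one e.N),
      e.value_constKnown_of_mem _ _ (Finset.mem_Icc.2 ⟨by omega, le_rfl⟩)]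
  · intro n hn hne
    rw [Finset.mem_Icc] at hn
    rw [e.value_constKnown_of_mem _ _ (Finset.mem_Icc.2 ⟨by omega, by omega⟩),
      e.value_constKnown_of_mem _ _ (Finset.mem_Icc.2 ⟨by omega, by omega⟩), sub_self, smul_zero]

theorem shifted_stretched (h : e.Known → E) (next : E) :
    e.shifted .stretched h next = next :=
  e.value_of_lt _ _ (lt_add_one e.N)

theorem shifted_oneStep_of_eq_zero (hN : e.N = 0) (h : e.Known → E) (next : E) :
    e.shifted .oneStep h next = next :=
  e.value_of_lt _ _ (by omega)

theorem shifted_oneStep_constKnown (hN : e.N ≠ 0) (x next : E) :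
    e.shifted .oneStep (e.constKnown x) next = x := by
  have h0 := e.N_nonneg
  have hmin := min_le_right e.P 0
  exact e.value_constKnown_of_mem _ _ (Finset.mem_Icc.2 ⟨by omega, by omega⟩)

/-- In the one-step reading the shift by 1 is the unknown if `N = 0` but a known value if `N > 0`;
`hc` excludes mixing the two cases. -/
theorem shifted_constKnown_eq (a b : DerivativeExpansion) (c : ShiftConvention)
    (hc : c = ShiftConvention.oneStep → (a.N = 0 ↔ b.N = 0)) (x next : E) :
    a.shifted c (a.constKnown x) next = b.shifted c (b.constKnown x) next := by
  cases c with
  | stretched => rw [shifted_stretched, shifted_stretched]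
  | oneStep =>
    by_cases ha : a.N = 0
    · rw [a.shifted_oneStep_of_eq_zero ha, b.shifted_oneStep_of_eq_zero ((hc rfl).1 ha)]
    · rw [a.shifted_oneStep_constKnown ha,
        b.shifted_oneStep_constKnown (mt (hc rfl).2 ha)]

/-- At constant known values, changing the scheme amounts to rescaling the time step. -/
theorem expand_constKnown_eq [AddCommGroup E] [Module ℝ E] {A B : Type*}
    (a b : DerivativeExpansion) (c : ShiftConvention)
    (hc : c = ShiftConvention.oneStep → (a.N = 0 ↔ b.N = 0)) (F : E → E → A → E → B)
    (x next : E) (w : A) (δ : ℝ) :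
    a.expand c F next w (a.constKnown x) δ =
      b.expand c F next w (b.constKnown x) (b.α b.N / a.α a.N * δ) := by
  have hb := b.α_N_ne_zero
  simp only [expand, increment_constKnown, value_constKnown_zero, smul_smul,
    shifted_constKnown_eq a b c hc]
  congr 2
  rw [mul_inv, inv_div, mul_right_comm, div_mul_cancel₀ _ hb, mul_comm]

end DerivativeExpansion

/-! ### Independence of the standardized system of the expansion -/

section Restart

variable {ι κ ν ε η : Type*}

/-- The variable matched to equation `i` occurs in it, so the equation takes two distinct values,
not both zero. -/
theorem StructurallyNonsingular.exists_ne_zero {Q σ : Type*} {F : Q → (σ → ℝ) → η → ℝ}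
    (hF : StructurallyNonsingular F) (i : η) : ∃ q y, F q y i ≠ 0 := by
  obtain ⟨m, hm⟩ := hF
  obtain ⟨q, y, y', -, hne⟩ := hm i
  by_contra! h0
  exact hne ((h0 q y).trans (h0 q y').symm)

variable [Fintype ι] [Fintype ν] [Fintype η]

theorem IsDerivedReducedSystem.exists_proportional
    {K : (ι → ℝ) → (ι → ℝ) → (ν → ℝ) → (ι → ℝ) → η → ℝ}
    {c : ShiftConvention} {a b : DerivativeExpansion}
    (hc : c = ShiftConvention.oneStep → (a.N = 0 ↔ b.N = 0))
    {Ka : (ι ⊕ ν → ℝ) × (a.Known → ι → ℝ) × ℝ → η → ℝ}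
    {Kb : (ι ⊕ ν → ℝ) × (b.Known → ι → ℝ) × ℝ → η → ℝ}
    (hKa : IsDerivedReducedSystem a c K Ka) (hKb : IsDerivedReducedSystem b c K Kb) (i : η) :
    ∃ r : ℝ, r ≠ 0 ∧ ∀ x y,
      standardizedRestart Ka x y i = r * standardizedRestart Kb x y i := by
  obtain ⟨ρa, -, hρa⟩ := hKa.derived
  obtain ⟨ρb, hρb0, hρb⟩ := hKb.derived
  set t := b.α b.N / a.α a.N
  have ht : t ≠ 0 := div_ne_zero b.α_N_ne_zero a.α_N_ne_zero
  have lim_a (x : ι → ℝ) (y : ι ⊕ ν → ℝ) :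
      Tendsto (fun δ : ℝ => Ka (y, a.constKnown x, δ) i) (𝓝[≠] 0)
        (𝓝 (Ka (y, a.constKnown x, 0) i)) := by
    have hcont := hKa.contDiff.continuous
    have : Continuous fun δ : ℝ => Ka (y, a.constKnown x, δ) i := by fun_prop
    exact (this.tendsto 0).mono_left nhdsWithin_le_nhds
  have lim_b (x : ι → ℝ) (y : ι ⊕ ν → ℝ) :
      Tendsto (fun δ : ℝ => Kb (y, b.constKnown x, t * δ) i) (𝓝[≠] 0)
        (𝓝 (Kb (y, b.constKnown x, 0) i)) := by
    have hcont := hKb.contDiff.continuous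
    have : Continuous fun δ : ℝ => Kb (y, b.constKnown x, t * δ) i := by fun_prop
    simpa using (this.tendsto 0).mono_left nhdsWithin_le_nhds
  let q : ℝ → ℝ := fun δ => ρa i δ / ρb i (t * δ)
  have hq (x : ι → ℝ) (y : ι ⊕ ν → ℝ) (δ : ℝ) (hδ : δ ≠ 0) :
      Ka (y, a.constKnown x, δ) i = q δ * Kb (y, b.constKnown x, t * δ) i := by
    have htδ := mul_ne_zero ht hδ
    rw [hρa _ _ _ hδ, hρb _ _ _ htδ, a.expand_constKnown_eq b c hc, ← mul_assoc,
      div_mul_cancel₀ _ (hρb0 i _ htδ)]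
  obtain ⟨xb, yb, hb⟩ := hKb.structurallyNonsingular.exists_ne_zero i
  obtain ⟨xa, ya, ha⟩ := hKa.structurallyNonsingular.exists_ne_zero i
  -- One point where `Kb` does not vanish at `δ = 0` suffices to find the limit of `q`, which then
  -- serves all `x` and `y`.
  have lim_q : Tendsto q (𝓝[≠] 0)
      (𝓝 (Ka (yb, a.constKnown xb, 0) i / Kb (yb, b.constKnown xb, 0) i)) := by
    refine ((lim_a xb yb).div (lim_b xb yb) hb).congr' ?_
    filter_upwards [self_mem_nhdsWithin, (lim_b xb yb).eventually_ne hb] with δ hδ hne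
    rw [Pi.div_apply, hq xb yb δ hδ, mul_div_cancel_right₀ _ hne]
  have key (x : ι → ℝ) (y : ι ⊕ ν → ℝ) : Ka (y, a.constKnown x, 0) i =
      Ka (yb, a.constKnown xb, 0) i / Kb (yb, b.constKnown xb, 0) i *
        Kb (y, b.constKnown x, 0) i := by
    refine tendsto_nhds_unique (lim_a x y) ((lim_q.mul (lim_b x y)).congr' ?_)
    filter_upwards [self_mem_nhdsWithin] with δ hδ
    exact (hq x y δ hδ).symm
  -- A zero ratio would make component `i` of `Ka` vanish identically at `δ = 0`.
  refine ⟨_, fun h0 => ha ?_, key⟩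
  rw [key xa ya, h0, zero_mul]

/-! ### Restart values -/

/-- Eliminating `W'` index by index turns the nonstandard condition on `H` into one on `K` alone;
choice reassembles the witnesses into a germ. -/
theorem isRestartValue_coe {H : (ι → ℝ) → (ι → ℝ) → (κ → ℝ) × (ν → ℝ) → (ι → ℝ) → ε → ℝ}
    {K : (ι → ℝ) → (ι → ℝ) → (ν → ℝ) → (ι → ℝ) → η → ℝ} (hHK : EliminatesImpulsive H K)
    {e : DerivativeExpansion} {c : ShiftConvention} {d : ℕ → ℝ} {h : ℕ → e.Known → ι → ℝ}
    {y : ι ⊕ ν → ℝ} :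
    IsRestartValue e c H (d : Nst ℝ) (h : Nst (e.Known → ι → ℝ)) y ↔
      ∃ Y : ℕ → ι ⊕ ν → ℝ, Tendsto Y (hyperfilter ℕ : Filter ℕ) (𝓝 y) ∧
        ∀ᶠ n in (hyperfilter ℕ : Filter ℕ),
          e.expand c K (Y n ∘ Sum.inl) (Y n ∘ Sum.inr) (h n) (d n) = 0 := by
  constructor
  · rintro ⟨Y, W', heq, hst⟩
    induction Y, W' using Germ.inductionOn₂ with
    | _ Y W' =>
      refine ⟨Y, hasStandardPart_coe.1 hst, (Germ.coe_eq.1 heq).mono fun n hn => ?_⟩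
      exact (hHK _ _ _ _).2 ⟨W' n, hn⟩
  · rintro ⟨Y, hY, hK⟩
    have hex : ∀ n, ∃ w' : κ → ℝ,
        e.expand c K (Y n ∘ Sum.inl) (Y n ∘ Sum.inr) (h n) (d n) = 0 →
          e.expand c H (Y n ∘ Sum.inl) (w', Y n ∘ Sum.inr) (h n) (d n) = 0 := fun n => by
      by_cases h0 : e.expand c K (Y n ∘ Sum.inl) (Y n ∘ Sum.inr) (h n) (d n) = 0
      · obtain ⟨w', hw'⟩ := (hHK _ _ _ _).1 h0
        exact ⟨w', fun _ => hw'⟩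
      -- Arbitrary value at indices where the reduced system fails; these are negligible for the
      -- ultrafilter.
      · exact ⟨0, fun h1 => absurd h1 h0⟩
    choose W' hW' using hex
    exact ⟨(Y : Nst (ι ⊕ ν → ℝ)), (W' : Nst (κ → ℝ)),
      Germ.coe_eq.2 (hK.mono fun n hn => hW' n hn), hasStandardPart_coe.2 hY⟩

theorem IsDerivedReducedSystem.expand_eq_zero_iff
    {K : (ι → ℝ) → (ι → ℝ) → (ν → ℝ) → (ι → ℝ) → η → ℝ}
    {c : ShiftConvention} {e : DerivativeExpansion}
    {Kd : (ι ⊕ ν → ℝ) × (e.Known → ι → ℝ) × ℝ → η → ℝ}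
    (hKd : IsDerivedReducedSystem e c K Kd) (y : ι ⊕ ν → ℝ) (h : e.Known → ι → ℝ) {δ : ℝ}
    (hδ : δ ≠ 0) :
    e.expand c K (y ∘ Sum.inl) (y ∘ Sum.inr) h δ = 0 ↔ Kd (y, h, δ) = 0 := by
  obtain ⟨ρ, hρ0, hρ⟩ := hKd.derived
  simp only [funext_iff, hρ y h δ hδ, Pi.zero_apply, mul_eq_zero, hρ0 _ δ hδ, false_or]

/-- Near a zero at which the partial derivative in the first variable is bijective, the equation
can be solved for this variable, continuously at the base point. -/
theorem exists_tendsto_of_bijective_fderiv {E P F : Type*}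
    [NormedAddCommGroup E] [NormedSpace ℝ E] [CompleteSpace E]
    [NormedAddCommGroup P] [NormedSpace ℝ P] [CompleteSpace P]
    [NormedAddCommGroup F] [NormedSpace ℝ F] [CompleteSpace F]
    {f : E × P → F} (hf : ContDiff ℝ 1 f) {y : E} {p : P}
    (hbij : Function.Bijective (fderiv ℝ (fun z => f (z, p)) y)) :
    ∃ ψ : P → E, Tendsto ψ (𝓝 p) (𝓝 y) ∧ ∀ᶠ q in 𝓝 p, f (ψ q, q) = f (y, p) := by
  -- The factors are swapped because `implicitFunctionOfProdDomain` solves for the second one.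
  have hg : ContDiff ℝ 1 (fun u : P × E => f (u.2, u.1)) := by fun_prop
  have hstrict := hg.hasStrictFDerivAt (x := (p, y)) one_ne_zero
  have hpartial : HasFDerivAt (fun z => f (z, p))
      ((fderiv ℝ (fun u : P × E => f (u.2, u.1)) (p, y)).comp (.inr ℝ P E)) y :=
    hstrict.hasFDerivAt.comp (f := fun z : E => (p, z)) y (hasFDerivAt_prodMk_right p y)
  rw [hpartial.fderiv] at hbij
  have hinv : ((fderiv ℝ (fun u : P × E => f (u.2, u.1)) (p, y)).comp
      (.inr ℝ P E)).IsInvertible :=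
    ⟨.ofBijective _ (LinearMap.ker_eq_bot.2 hbij.1) (LinearMap.range_eq_top.2 hbij.2),
      ContinuousLinearEquiv.coe_ofBijective _ _ _⟩
  exact ⟨hstrict.implicitFunctionOfProdDomain hinv,
    hstrict.tendsto_implicitFunctionOfProdDomain hinv,
    hstrict.eventually_apply_implicitFunctionOfProdDomain hinv⟩

theorem IsDerivedReducedSystem.isStandardization
    {H : (ι → ℝ) → (ι → ℝ) → (κ → ℝ) × (ν → ℝ) → (ι → ℝ) → ε → ℝ}
    {K : (ι → ℝ) → (ι → ℝ) → (ν → ℝ) → (ι → ℝ) → η → ℝ} (hHK : EliminatesImpulsive H K)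
    {c : ShiftConvention} {e : DerivativeExpansion}
    {Kd : (ι ⊕ ν → ℝ) × (e.Known → ι → ℝ) × ℝ → η → ℝ}
    (hKd : IsDerivedReducedSystem e c K Kd) {xminus : ι → ℝ}
    {d : Nst ℝ} {h : Nst (e.Known → ι → ℝ)} (hd : IsPositiveInfinitesimal d)
    (hh : HasStandardPart h (e.constKnown xminus)) :
    IsStandardization e c H d h (standardizedRestart Kd xminus) := by
  induction d, h using Germ.inductionOn₂ with
  | _ d h =>
    obtain ⟨hdpos, hd0⟩ := isPositiveInfinitesimal_coe.1 hd
    have hh := hasStandardPart_coe.1 hh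
    refine ⟨fun y hy => ?_, fun y hy hbij => ?_⟩
    · obtain ⟨Y, hY, hK⟩ := (isRestartValue_coe hHK).1 hy
      have hlim := (hKd.contDiff.continuous.tendsto (y, e.constKnown xminus, 0)).comp
        (hY.prodMk_nhds (hh.prodMk_nhds hd0))
      refine tendsto_nhds_unique hlim (tendsto_const_nhds.congr' ?_)
      filter_upwards [hK, hdpos] with n hn hpos
      exact ((hKd.expand_eq_zero_iff (Y n) (h n) hpos.ne').1 hn).symm
    · obtain ⟨ψ, hψ, hψ0⟩ := exists_tendsto_of_bijective_fderiv hKd.contDiff hbij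
      have hp := hh.prodMk_nhds hd0
      refine (isRestartValue_coe hHK).2 ⟨fun n => ψ (h n, d n), hψ.comp hp, ?_⟩
      filter_upwards [hp.eventually hψ0, hdpos] with n hn hpos
      exact (hKd.expand_eq_zero_iff _ _ hpos.ne').2 (hn.trans hy)

end Restart

/-- Rescaling the components of a map by nonzero constants preserves bijectivity of the
derivative. -/
theorem bijective_fderiv_of_proportional {E η : Type*} [NormedAddCommGroup E] [NormedSpace ℝ E]
    [Fintype η] {f g : E → η → ℝ} {y : E} (hg : DifferentiableAt ℝ g y) {r : η → ℝ}
    (hr : ∀ i, r i ≠ 0) (hfg : ∀ z i, f z i = r i * g z i)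
    (hbij : Function.Bijective (fderiv ℝ f y)) : Function.Bijective (fderiv ℝ g y) := by
  have hf : HasFDerivAt f
      (ContinuousLinearMap.pi fun i => r i • (ContinuousLinearMap.proj i).comp (fderiv ℝ g y)) y := by
    rw [hasFDerivAt_pi']
    intro i
    simp only [hfg]
    exact ((hasFDerivAt_pi'.1 hg.hasFDerivAt) i).const_mul (r i)
  have hcomp : ⇑(fderiv ℝ f y) = (Equiv.piCongrRight fun i => Equiv.mulLeft₀ (r i) (hr i)) ∘
      ⇑(fderiv ℝ g y) := by
    rw [hf.fderiv]
    rfl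
  rwa [hcomp, Equiv.comp_bijective] at hbij

theorem mainTheorem3 {ι κ ν ε η : Type*} [Fintype ι] [Fintype κ] [Fintype ν] [Fintype ε] [Fintype η]
    (H : (ι → ℝ) → (ι → ℝ) → (κ → ℝ) × (ν → ℝ) → (ι → ℝ) → ε → ℝ)
    (K : (ι → ℝ) → (ι → ℝ) → (ν → ℝ) → (ι → ℝ) → η → ℝ)
    (hHK : EliminatesImpulsive H K)
    (c : ShiftConvention) (a b : DerivativeExpansion)
    (hc : c = ShiftConvention.oneStep → (a.N = 0 ↔ b.N = 0))
    (Ka : (ι ⊕ ν → ℝ) × (a.Known → ι → ℝ) × ℝ → η → ℝ)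
    (Kb : (ι ⊕ ν → ℝ) × (b.Known → ι → ℝ) × ℝ → η → ℝ)
    (hKa : IsDerivedReducedSystem a c K Ka) (hKb : IsDerivedReducedSystem b c K Kb)
    (xminus : ι → ℝ) :
    (∀ y, standardizedRestart Ka xminus y = 0 ↔ standardizedRestart Kb xminus y = 0) ∧
    (∀ (d : Nst ℝ) (ha : Nst (a.Known → ι → ℝ)) (hb : Nst (b.Known → ι → ℝ)),
      IsPositiveInfinitesimal d →
      HasStandardPart ha (a.constKnown xminus) → HasStandardPart hb (b.constKnown xminus) →
      IsStandardization a c H d ha (standardizedRestart Ka xminus) ∧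
      IsStandardization b c H d hb (standardizedRestart Ka xminus) ∧
      ∀ y, Function.Bijective (fderiv ℝ (standardizedRestart Ka xminus) y) →
        (IsRestartValue a c H d ha y ↔ IsRestartValue b c H d hb y)) := by
  choose r hr hprop using fun i => hKa.exists_proportional hc hKb i
  have hiff : ∀ y, standardizedRestart Ka xminus y = 0 ↔ standardizedRestart Kb xminus y = 0 := by
    intro y
    simp only [funext_iff, hprop, Pi.zero_apply, mul_eq_zero, hr, false_or]
  refine ⟨hiff, fun d ha hb hd hha hhb => ?_⟩
  have hSa := hKa.isStandardization hHK hd hha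
  have hSb : IsStandardization b c H d hb (standardizedRestart Ka xminus) := by
    have hSb := hKb.isStandardization hHK hd hhb
    -- The Jacobian condition is stated for `Ka`; proportionality carries it over to `Kb`.
    refine ⟨fun y hy => (hiff y).2 (hSb.1 y hy), fun y hy hbij => hSb.2 y ((hiff y).1 hy) ?_⟩
    have hdiff : Differentiable ℝ Kb := hKb.contDiff.differentiable one_ne_zero
    refine bijective_fderiv_of_proportional ?_ hr (fun z i => hprop i xminus z) hbij
    unfold standardizedRestart
    fun_prop
  exact ⟨hSa, hSb, fun y hbij =>
    ⟨fun h => hSb.2 y (hSa.1 y h) hbij, fun h => hSa.2 y (hSb.1 y h) hbij⟩⟩
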